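/- For $\lambda>-1$ and $\mu\in\mathbb{C}$ let $W_{\lambda,\mu}(z)=\sum_{n=0}^\infty \frac{z^n}{n!\,\Gamma(\lambda n+\mu)}$ be the Wright function (with $1/\Gamma=0$ at the poles of $\Gamma$), and for $0<\gamma<1$ let $M_\gamma(z)=W_{-\gamma,1-\gamma}(-z)$. Let $\mathrm{Ai}$ be the (entire) Airy function of the first kind, $\mathrm{Ai}'$ its derivative, and $K_\nu$ the modified Bessel function of the second kind on its principal branch, $\arg\in(-\pi,\pi]$. Then: (i) for every $z\in\mathbb{C}$, $$M_{2/3}(z)=\left[3^{-1/3}\,z\,\mathrm{Ai}\!\left(\frac{z^2}{3^{4/3}}\right)-3^{1/3}\,\mathrm{Ai}'\!\left(\frac{z^2}{3^{4/3}}\right)\right]e^{-2z^3/27};$$ (ii) for every $z\in\mathbb{C}\setminus\{0\}$ with $-\pi/3<\arg z\le\pi/3$ (in particular for every real $z>0$), $$M_{2/3}(z)=\frac{z^2}{3^{3/2}\,\pi}\left[K_{1/3}\!\left(\frac{2z^3}{27}\right)+K_{2/3}\!\left(\frac{2z^3}{27}\right)\right]e^{-2z^3/27}.$$ -/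

import Mathlib

noncomputable section

/-- The Wright function `W_{lam,mu}(z) = ∑ zⁿ / (n! Γ(n lam + mu))` (for `lam > -1`).
At the poles of `Γ` the term vanishes, since `Complex.Gamma` is `0` there and so is its inverse. -/
def wrightW (lam : ℝ) (mu z : ℂ) : ℂ :=
  ∑' n : ℕ, z ^ n / ((n.factorial : ℂ) * Complex.Gamma ((n : ℂ) * (lam : ℂ) + mu))

/-- The function `M_γ(z) = W_{-γ,1-γ}(-z)` (for `0 < γ < 1`). -/
def wrightM (γ : ℝ) (z : ℂ) : ℂ :=
  wrightW (-γ) (1 - (γ : ℂ)) (-z)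

/-- The solution `f` of `w'' = z w` with `f(0) = 1`, `f'(0) = 0`:
`f(z) = ∑ 3ᵏ (1/3)ₖ z^{3k} / (3k)!`, where `(a)ₖ = a (a+1) ⋯ (a+k-1)`. -/
def airyF (z : ℂ) : ℂ :=
  ∑' k : ℕ, 3 ^ k * (ascPochhammer ℂ k).eval (1 / 3 : ℂ) * z ^ (3 * k)
    / ((3 * k).factorial : ℂ)

/-- The solution `g` of `w'' = z w` with `g(0) = 0`, `g'(0) = 1`:
`g(z) = ∑ 3ᵏ (2/3)ₖ z^{3k+1} / (3k+1)!`. -/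
def airyG (z : ℂ) : ℂ :=
  ∑' k : ℕ, 3 ^ k * (ascPochhammer ℂ k).eval (2 / 3 : ℂ) * z ^ (3 * k + 1)
    / ((3 * k + 1).factorial : ℂ)

/-- The Airy function of the first kind `Ai(z) = c₁ f(z) - c₂ g(z)`, with
`c₁ = Ai(0) = 3^{-2/3} / Γ(2/3)` and `c₂ = -Ai'(0) = 3^{-1/3} / Γ(1/3)`. -/
def airyAi (z : ℂ) : ℂ :=
  (((3 : ℝ) ^ (-(2 / 3) : ℝ) / Real.Gamma (2 / 3) : ℝ) : ℂ) * airyF z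
    - (((3 : ℝ) ^ (-(1 / 3) : ℝ) / Real.Gamma (1 / 3) : ℝ) : ℂ) * airyG z

/-- The modified Bessel function of the first kind (principal branch)
`I_ν(z) = (z/2)^ν ∑ (z²/4)ᵏ / (k! Γ(ν + k + 1))`. -/
def besselI (ν z : ℂ) : ℂ :=
  (z / 2) ^ ν *
    ∑' k : ℕ, (z ^ 2 / 4) ^ k / ((k.factorial : ℂ) * Complex.Gamma (ν + (k : ℂ) + 1))

open scoped Classical in
/-- The modified Bessel function of the second kind (principal branch)
`K_ν(z) = (π/2) (I_{-ν}(z) - I_ν(z)) / sin(ν π)`, the right-hand side being replaced by its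
limit in the order when `ν` is an integer. -/
def besselK (ν z : ℂ) : ℂ :=
  if ∃ m : ℤ, ν = (m : ℂ) then
    Filter.limUnder (nhdsWithin ν {ν}ᶜ) fun μ : ℂ =>
      (Real.pi : ℂ) / 2 * (besselI (-μ) z - besselI μ z) / Complex.sin (μ * (Real.pi : ℂ))
  else
    (Real.pi : ℂ) / 2 * (besselI (-ν) z - besselI ν z) / Complex.sin (ν * (Real.pi : ℂ))

end

open Filter Topology

/-! The reflection-free part of the argument is an initial value problem. By the functional equation
of `1/Γ`, the Taylor coefficients of `M_{2/3}` obey a three-step recurrence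
(`wrightCoeff_recurrence`), which says that `M_{2/3}` solves `w'' = -(4/9) z² w' - (10/9) z w`.
Airy's equation shows that the right side of (i) solves the same equation; both have value
`1/Γ(1/3)` and slope `1/(3 Γ(2/3))` at `0`, so `eq_zero_of_linear_ode` makes them equal.

For (ii), the series for `f`, `g`, `f'`, `g'` are Bessel series of orders `-1/3`, `1/3`, `2/3`,
`-2/3` (`tsum_eq_besselSeries`). With `u = z/3`, the `Ai` part of (i) is `u² (I_{-1/3} -
I_{1/3})(2u³)` and the `Ai'` part is `u² (I_{-2/3} - I_{2/3})(2u³)`, up to the exponential; the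
sector for `arg z` makes the principal cube root of `u³` equal to `u`. -/

/-! ### Power series and uniqueness for linear equations -/

/-- The termwise derivative of a lacunary power series converging absolutely for every radius
again converges absolutely for every radius. -/
theorem summable_norm_mul_cast_mul_pow_pred {c : ℕ → ℂ} {e : ℕ → ℕ}
    (hc : ∀ r : ℝ, 0 ≤ r → Summable fun k => ‖c k‖ * r ^ e k) (r : ℝ) (hr : 0 ≤ r) :
    Summable fun k => ‖c k * (e k : ℂ)‖ * r ^ (e k - 1) := by
  -- Doubling the radius absorbs the factor `e k ≤ 2 ^ e k`; the `+ 1` makes the base at least `1`,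
  -- so lowering the exponent is harmless.
  refine Summable.of_nonneg_of_le (fun k => by positivity) (fun k => ?_)
    (hc (2 * (r + 1)) (by positivity))
  rw [norm_mul, Complex.norm_natCast, mul_assoc, mul_pow]
  have h2 : (e k : ℝ) ≤ 2 ^ e k := by exact_mod_cast (Nat.lt_two_pow_self (n := e k)).le
  have h3 : r ^ (e k - 1) ≤ (r + 1) ^ e k :=
    (pow_le_pow_left₀ hr (by linarith) _).trans (pow_le_pow_right₀ (by linarith) (Nat.sub_le _ _))
  gcongr

theorem summable_mul_pow_of_norm {c : ℕ → ℂ} {e : ℕ → ℕ}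
    (hc : ∀ r : ℝ, 0 ≤ r → Summable fun k => ‖c k‖ * r ^ e k) (z : ℂ) :
    Summable fun k => c k * z ^ e k :=
  Summable.of_norm (by simpa using hc ‖z‖ (norm_nonneg z))

/-- An everywhere absolutely convergent lacunary power series may be differentiated termwise. -/
theorem hasDerivAt_tsum_mul_pow {c : ℕ → ℂ} {e : ℕ → ℕ}
    (hc : ∀ r : ℝ, 0 ≤ r → Summable fun k => ‖c k‖ * r ^ e k) (z : ℂ) :
    HasDerivAt (fun w => ∑' k, c k * w ^ e k) (∑' k, c k * (e k : ℂ) * z ^ (e k - 1)) z := by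
  have hz : z ∈ Metric.ball (0 : ℂ) (‖z‖ + 1) := by simp
  have hg : ∀ k y, y ∈ Metric.ball (0 : ℂ) (‖z‖ + 1) →
      HasDerivAt (fun w => c k * w ^ e k) (c k * (e k : ℂ) * y ^ (e k - 1)) y := fun k y _ => by
    rw [mul_assoc]
    exact (hasDerivAt_pow (e k) y).const_mul (c k)
  have hg' : ∀ k y, y ∈ Metric.ball (0 : ℂ) (‖z‖ + 1) →
      ‖c k * (e k : ℂ) * y ^ (e k - 1)‖ ≤ ‖c k * (e k : ℂ)‖ * (‖z‖ + 1) ^ (e k - 1) := by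
    intro k y hy
    rw [mem_ball_zero_iff] at hy
    rw [norm_mul _ (y ^ _), norm_pow]
    exact mul_le_mul_of_nonneg_left (pow_le_pow_left₀ (norm_nonneg _) hy.le _) (norm_nonneg _)
  exact hasDerivAt_tsum_of_isPreconnected
    (summable_norm_mul_cast_mul_pow_pred hc (‖z‖ + 1) (by positivity)) Metric.isOpen_ball
    (convex_ball _ _).isPreconnected hg hg' hz (summable_mul_pow_of_norm hc z) hz

/-- A geometric bound for a sequence contracting along steps of length three. -/
theorem summable_of_three_step_contraction {g : ℕ → ℝ} (hg : ∀ n, 0 ≤ g n)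
    (h : ∀ᶠ n in atTop, g (n + 3) ≤ 1 / 8 * g n) : Summable g := by
  obtain ⟨N, hN⟩ := eventually_atTop.1 h
  -- Three steps multiply by `1/8 = (1/2)³`, so `g n ≤ C (1/2)ⁿ` propagates once it holds for all `n
  -- < N + 3`.
  set C := ∑ n ∈ Finset.range (N + 3), g n * 2 ^ n with hC
  have key : ∀ n, g n ≤ C * (1 / 2) ^ n := by
    intro n
    induction n using Nat.strong_induction_on with
    | _ n ih =>
      by_cases hn : n < N + 3
      · have : g n * 2 ^ n ≤ C :=
          Finset.single_le_sum (f := fun n => g n * 2 ^ n)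
            (fun i _ => mul_nonneg (hg i) (by positivity)) (Finset.mem_range.2 hn)
        calc g n = g n * 2 ^ n * (1 / 2) ^ n := by
              rw [mul_assoc, ← mul_pow]; norm_num
          _ ≤ _ := by gcongr
      · obtain ⟨m, rfl⟩ : ∃ m, n = m + 3 := ⟨n - 3, by omega⟩
        have h1 := hN m (by omega)
        have h2 := ih m (by omega)
        rw [pow_add]
        linarith
  exact Summable.of_nonneg_of_le hg key ((summable_geometric_of_lt_one (by norm_num)
    (by norm_num)).mul_left C)

/-- A solution of a second-order linear equation on `ℂ` with continuous coefficients and vanishing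
initial data is zero. -/
theorem eq_zero_of_linear_ode {d d₁ p q : ℂ → ℂ} (hp : Continuous p) (hq : Continuous q)
    (hd : ∀ z, HasDerivAt d (d₁ z) z)
    (hd₁ : ∀ z, HasDerivAt d₁ (p z * d₁ z + q z * d z) z) (h0 : d 0 = 0) (h1 : d₁ 0 = 0) (z : ℂ) :
    d z = 0 := by
  -- Grönwall's inequality is applied to the pair `(d, d₁)` along the segment from `0` to `z`.
  have hline : ∀ t : ℝ, HasDerivAt (fun t : ℝ => (t : ℂ) * z) z t := fun t => by
    simpa using (Complex.ofRealCLM.hasDerivAt (x := t)).mul_const z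
  have hD : ∀ t : ℝ, HasDerivAt (fun t : ℝ => (d (t * z), d₁ (t * z)))
      (d₁ (t * z) * z, (p (t * z) * d₁ (t * z) + q (t * z) * d (t * z)) * z) t := fun t =>
    ((hd _).comp t (hline t)).prodMk ((hd₁ _).comp t (hline t))
  have hcont : Continuous fun t : ℝ => (1 + ‖p (t * z)‖ + ‖q (t * z)‖) * ‖z‖ := by fun_prop
  obtain ⟨K, hK⟩ := (isCompact_Icc (a := (0 : ℝ)) (b := 1)).bddAbove_image hcont.continuousOn
  have := eq_zero_of_abs_deriv_le_mul_abs_self_of_eq_zero_right (K := K) (a := 0) (b := 1)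
    (fun t _ => (hD t).continuousAt.continuousWithinAt) (fun t _ => (hD t).hasDerivWithinAt)
    (by simp [h0, h1]) (fun t ht => by
      have hKt := hK ⟨t, Set.Ico_subset_Icc_self ht, rfl⟩
      refine le_trans ?_ (mul_le_mul_of_nonneg_right hKt (norm_nonneg _))
      have e1 := norm_fst_le (d (t * z), d₁ (t * z))
      have e2 := norm_snd_le (d (t * z), d₁ (t * z))
      set D := ‖(d (t * z), d₁ (t * z))‖
      simp only at e1 e2
      have hD0 : 0 ≤ D := (norm_nonneg _).trans e1
      have hz := norm_nonneg z
      have hP := norm_nonneg (p (t * z))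
      have hQ := norm_nonneg (q (t * z))
      rw [norm_prod_le_iff]
      constructor
      · simp only [norm_mul]
        calc ‖d₁ (t * z)‖ * ‖z‖ ≤ D * ‖z‖ := by gcongr
          _ = (1 * ‖z‖) * D := by ring
          _ ≤ _ := by gcongr; linarith
      · simp only
        rw [norm_mul]
        calc _ ≤ (‖p (t * z)‖ * D + ‖q (t * z)‖ * D) * ‖z‖ := by
              gcongr
              refine (norm_add_le _ _).trans ?_
              rw [norm_mul, norm_mul]
              gcongr
          _ = ((‖p (t * z)‖ + ‖q (t * z)‖) * ‖z‖) * D := by ring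
          _ ≤ _ := by gcongr; linarith) 1 (by simp)
  simpa using congrArg Prod.fst this

/-! ### The Airy equation -/

/-- The coefficients of the two basic solutions of the Airy equation (`m = 0` and `m = 1`) give an
everywhere convergent series. -/
theorem summable_of_airy_recurrence {c : ℕ → ℂ} {m : ℕ}
    (hc : ∀ k : ℕ, c (k + 1) * ((3 * k + 3 + m) * (3 * k + 2 + m)) = c k) (r : ℝ) (hr : 0 ≤ r) :
    Summable fun k => ‖c k‖ * r ^ (3 * k + m) := by
  refine summable_of_ratio_norm_eventually_le (r := 1 / 2) (by norm_num) ?_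
  filter_upwards [eventually_ge_atTop ⌈r ^ 3⌉₊] with k hk
  have hk' : r ^ 3 ≤ k := (Nat.le_ceil _).trans (by exact_mod_cast hk)
  rw [Real.norm_of_nonneg (by positivity), Real.norm_of_nonneg (by positivity), ← hc k, norm_mul]
  have : ‖((3 * k + 3 + m) * (3 * k + 2 + m) : ℂ)‖ = (3 * k + 3 + m) * (3 * k + 2 + m) := by
    rw [norm_mul]
    congr 1
    · exact_mod_cast Complex.norm_natCast (3 * k + 3 + m)
    · exact_mod_cast Complex.norm_natCast (3 * k + 2 + m)
  rw [this, show 3 * (k + 1) + m = 3 + (3 * k + m) by ring, pow_add]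
  have hm : (0 : ℝ) ≤ m := by positivity
  have hk0 : (0 : ℝ) ≤ k := by positivity
  have h2 : r ^ 3 ≤ 1 / 2 * ((3 * k + 3 + m) * (3 * k + 2 + m)) := by
    refine hk'.trans ?_
    nlinarith [mul_nonneg hm hk0]
  calc _ = ‖c (k + 1)‖ * r ^ (3 * k + m) * r ^ 3 := by ring
    _ ≤ ‖c (k + 1)‖ * r ^ (3 * k + m) * (1 / 2 * ((3 * k + 3 + m) * (3 * k + 2 + m))) := by gcongr
    _ = _ := by ring

/-- Two derivatives turn the term `k + 1` into `z` times the term `k`; the hypothesis `hm` (so `m`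
is `0` or `1`) kills the leading term. -/
theorem hasDerivAt_deriv_of_airy_recurrence {c : ℕ → ℂ} {m : ℕ} (hm : m * (m - 1) = 0)
    (hc : ∀ k : ℕ, c (k + 1) * ((3 * k + 3 + m) * (3 * k + 2 + m)) = c k) (z : ℂ) :
    HasDerivAt (fun w => ∑' k, c k * ((3 * k + m : ℕ) : ℂ) * w ^ (3 * k + m - 1))
      (z * ∑' k, c k * z ^ (3 * k + m)) z := by
  have hs := summable_norm_mul_cast_mul_pow_pred (e := fun k => 3 * k + m)
    (summable_of_airy_recurrence hc)
  have h := hasDerivAt_tsum_mul_pow (e := fun k => 3 * k + m - 1) hs z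
  have hs₂ := summable_mul_pow_of_norm
    (summable_norm_mul_cast_mul_pow_pred (e := fun k => 3 * k + m - 1) hs) z
  convert h using 1
  rw [hs₂.tsum_eq_zero_add, ← tsum_mul_left]
  have h0 : c 0 * ((3 * 0 + m : ℕ) : ℂ) * ((3 * 0 + m - 1 : ℕ) : ℂ) = 0 := by
    rw [mul_assoc, ← Nat.cast_mul]
    simp [hm]
  rw [h0, zero_mul, zero_add]
  refine tsum_congr fun k => ?_
  rw [show 3 * (k + 1) + m - 1 = 3 * k + m + 2 by omega,
    show 3 * k + m + 2 - 1 = 3 * k + m + 1 by omega, ← hc k]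
  push_cast
  ring

/-- The coefficients of `airyF`. -/
noncomputable def airyFCoeff (k : ℕ) : ℂ :=
  3 ^ k * (ascPochhammer ℂ k).eval (1 / 3 : ℂ) / ((3 * k).factorial : ℂ)

/-- The coefficients of `airyG`. -/
noncomputable def airyGCoeff (k : ℕ) : ℂ :=
  3 ^ k * (ascPochhammer ℂ k).eval (2 / 3 : ℂ) / ((3 * k + 1).factorial : ℂ)

theorem airyFCoeff_recurrence (k : ℕ) :
    airyFCoeff (k + 1) * ((3 * k + 3 + (0 : ℕ)) * (3 * k + 2 + (0 : ℕ))) = airyFCoeff k := by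
  have h : ((3 * k).factorial : ℂ) ≠ 0 := by exact_mod_cast (3 * k).factorial_ne_zero
  have h1 : (3 * k + 1 : ℂ) ≠ 0 := by exact_mod_cast (3 * k).succ_ne_zero
  have h2 : (3 * k + 2 : ℂ) ≠ 0 := by exact_mod_cast (3 * k + 1).succ_ne_zero
  have h3 : (3 * k + 3 : ℂ) ≠ 0 := by exact_mod_cast (3 * k + 2).succ_ne_zero
  rw [airyFCoeff, airyFCoeff, ascPochhammer_succ_eval, show 3 * (k + 1) = 3 * k + 1 + 1 + 1 by ring,
    Nat.factorial_succ, Nat.factorial_succ, Nat.factorial_succ]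
  push_cast
  rw [show (3 * k + 1 + 1 : ℂ) = 3 * k + 2 by ring, show (3 * k + 2 + 1 : ℂ) = 3 * k + 3 by ring]
  field_simp
  ring

theorem airyGCoeff_recurrence (k : ℕ) :
    airyGCoeff (k + 1) * ((3 * k + 3 + (1 : ℕ)) * (3 * k + 2 + (1 : ℕ))) = airyGCoeff k := by
  have h : ((3 * k + 1).factorial : ℂ) ≠ 0 := by exact_mod_cast (3 * k + 1).factorial_ne_zero
  have h1 : (3 * k + 2 : ℂ) ≠ 0 := by exact_mod_cast (3 * k + 1).succ_ne_zero
  have h2 : (3 * k + 3 : ℂ) ≠ 0 := by exact_mod_cast (3 * k + 2).succ_ne_zero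
  have h3 : (3 * k + 4 : ℂ) ≠ 0 := by exact_mod_cast (3 * k + 3).succ_ne_zero
  rw [airyGCoeff, airyGCoeff, ascPochhammer_succ_eval,
    show 3 * (k + 1) + 1 = 3 * k + 1 + 1 + 1 + 1 by ring,
    Nat.factorial_succ (3 * k + 1 + 1 + 1), Nat.factorial_succ (3 * k + 1 + 1),
    Nat.factorial_succ (3 * k + 1)]
  push_cast
  rw [show (3 * k + 1 + 1 : ℂ) = 3 * k + 2 by ring, show (3 * k + 2 + 1 : ℂ) = 3 * k + 3 by ring,
    show (3 * k + 3 + 1 : ℂ) = 3 * k + 4 by ring]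
  field_simp
  ring

theorem airyF_eq (z : ℂ) : airyF z = ∑' k, airyFCoeff k * z ^ (3 * k + 0) :=
  tsum_congr fun k => by rw [airyFCoeff]; ring

theorem airyG_eq (z : ℂ) : airyG z = ∑' k, airyGCoeff k * z ^ (3 * k + 1) :=
  tsum_congr fun k => by rw [airyGCoeff]; ring

/-- The termwise derivative of `airyF`. -/
noncomputable def airyFDeriv (z : ℂ) : ℂ :=
  ∑' k : ℕ, airyFCoeff k * ((3 * k + 0 : ℕ) : ℂ) * z ^ (3 * k + 0 - 1)

/-- The termwise derivative of `airyG`. -/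
noncomputable def airyGDeriv (z : ℂ) : ℂ :=
  ∑' k : ℕ, airyGCoeff k * ((3 * k + 1 : ℕ) : ℂ) * z ^ (3 * k + 1 - 1)

theorem hasDerivAt_airyF (z : ℂ) : HasDerivAt airyF (airyFDeriv z) z :=
  (funext airyF_eq : airyF = _) ▸
    hasDerivAt_tsum_mul_pow (summable_of_airy_recurrence airyFCoeff_recurrence) z

theorem hasDerivAt_airyG (z : ℂ) : HasDerivAt airyG (airyGDeriv z) z :=
  (funext airyG_eq : airyG = _) ▸
    hasDerivAt_tsum_mul_pow (summable_of_airy_recurrence airyGCoeff_recurrence) z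

theorem hasDerivAt_airyFDeriv (z : ℂ) : HasDerivAt airyFDeriv (z * airyF z) z :=
  airyF_eq z ▸ hasDerivAt_deriv_of_airy_recurrence (by norm_num) airyFCoeff_recurrence z

theorem hasDerivAt_airyGDeriv (z : ℂ) : HasDerivAt airyGDeriv (z * airyG z) z :=
  airyG_eq z ▸ hasDerivAt_deriv_of_airy_recurrence (by norm_num) airyGCoeff_recurrence z

theorem airyF_zero : airyF 0 = 1 := by
  rw [airyF, tsum_eq_single 0 fun k hk => by simp [hk]]
  simp

theorem airyG_zero : airyG 0 = 0 := by simp [airyG]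

theorem airyFDeriv_zero : airyFDeriv 0 = 0 := by
  rw [airyFDeriv, tsum_eq_single 0 fun k hk => by
    rw [zero_pow (by omega), mul_zero]]
  simp

theorem airyGDeriv_zero : airyGDeriv 0 = 1 := by
  rw [airyGDeriv, tsum_eq_single 0 fun k hk => by simp [hk]]
  simp [airyGCoeff]

/-- The complex number `3^{1/3}`. -/
noncomputable def cbrtThree : ℂ := (((3 : ℝ) ^ (1 / 3 : ℝ) : ℝ) : ℂ)

theorem cbrtThree_pow : cbrtThree ^ 3 = 3 := by
  rw [cbrtThree, ← Complex.ofReal_pow, ← Real.rpow_natCast, ← Real.rpow_mul (by norm_num)]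
  norm_num

theorem cbrtThree_ne_zero : cbrtThree ≠ 0 := fun h => by
  simpa [h] using cbrtThree_pow

theorem ofReal_three_rpow_neg_third : (((3 : ℝ) ^ (-(1 / 3) : ℝ) : ℝ) : ℂ) = cbrtThree⁻¹ := by
  rw [Real.rpow_neg (by norm_num), Complex.ofReal_inv, cbrtThree]

theorem ofReal_three_rpow_neg_two_thirds :
    (((3 : ℝ) ^ (-(2 / 3) : ℝ) : ℝ) : ℂ) = (cbrtThree ^ 2)⁻¹ := by
  rw [Real.rpow_neg (by norm_num), Complex.ofReal_inv, cbrtThree, ← Complex.ofReal_pow,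
    ← Real.rpow_natCast, ← Real.rpow_mul (by norm_num)]
  norm_num

theorem ofReal_three_rpow_four_thirds :
    (((3 : ℝ) ^ (4 / 3 : ℝ) : ℝ) : ℂ) = 3 * cbrtThree := by
  rw [show (4 / 3 : ℝ) = 1 + 1 / 3 by norm_num, Real.rpow_add (by norm_num), Complex.ofReal_mul,
    cbrtThree]
  norm_num

theorem airyAi_eq (z : ℂ) : airyAi z =
    (cbrtThree ^ 2)⁻¹ / Complex.Gamma (2 / 3) * airyF z
      - cbrtThree⁻¹ / Complex.Gamma (1 / 3) * airyG z := by
  rw [airyAi, Complex.ofReal_div, Complex.ofReal_div, ofReal_three_rpow_neg_third,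
    ofReal_three_rpow_neg_two_thirds, ← Complex.Gamma_ofReal, ← Complex.Gamma_ofReal]
  norm_num

/-- The derivative of the Airy function. -/
noncomputable def airyAiDeriv (z : ℂ) : ℂ :=
  (cbrtThree ^ 2)⁻¹ / Complex.Gamma (2 / 3) * airyFDeriv z
    - cbrtThree⁻¹ / Complex.Gamma (1 / 3) * airyGDeriv z

theorem hasDerivAt_airyAi (z : ℂ) : HasDerivAt airyAi (airyAiDeriv z) z :=
  (funext airyAi_eq : airyAi = _) ▸
    ((hasDerivAt_airyF z).const_mul _).sub ((hasDerivAt_airyG z).const_mul _)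

theorem hasDerivAt_airyAiDeriv (z : ℂ) : HasDerivAt airyAiDeriv (z * airyAi z) z := by
  convert! ((hasDerivAt_airyFDeriv z).const_mul _).sub ((hasDerivAt_airyGDeriv z).const_mul _)
    using 1
  rw [airyAi_eq]
  ring

/-! ### The differential equation of `M_{2/3}` -/

/-- The Taylor coefficients of `M_{2/3}`. -/
noncomputable def wrightCoeff (n : ℕ) : ℂ :=
  (-1) ^ n / (n.factorial : ℂ) * (Complex.Gamma ((1 - 2 * n) / 3))⁻¹

theorem wrightM_two_thirds_eq (z : ℂ) : wrightM (2 / 3) z = ∑' n, wrightCoeff n * z ^ n := by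
  refine tsum_congr fun n => ?_
  rw [wrightCoeff, neg_pow]
  have : (n : ℂ) * ((-(2 / 3) : ℝ) : ℂ) + (1 - ((2 / 3 : ℝ) : ℂ)) = (1 - 2 * n) / 3 := by
    push_cast
    ring
  rw [this, div_eq_mul_inv, mul_inv]
  ring

/-- Raising `n` by `3` lowers the Gamma argument by `2`, and the functional equation of `1/Γ` holds
at the poles too. It yields `2 (n + 1) (2 n + 5) / 9`, whose `n + 1` cancels against the factorial;
hence an equation of order two. -/
theorem wrightCoeff_recurrence (n : ℕ) :
    wrightCoeff (n + 3) * ((n + 2) * (n + 3)) = -(2 / 9) * (2 * n + 5) * wrightCoeff n := by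
  have h : (n.factorial : ℂ) ≠ 0 := by exact_mod_cast n.factorial_ne_zero
  have h1 : (n + 1 : ℂ) ≠ 0 := by exact_mod_cast n.succ_ne_zero
  have h2 : (n + 2 : ℂ) ≠ 0 := by exact_mod_cast (n + 1).succ_ne_zero
  have h3 : (n + 3 : ℂ) ≠ 0 := by exact_mod_cast (n + 2).succ_ne_zero
  have e1 := Complex.one_div_Gamma_eq_self_mul_one_div_Gamma_add_one ((1 - 2 * n) / 3 - 2)
  have e2 := Complex.one_div_Gamma_eq_self_mul_one_div_Gamma_add_one ((1 - 2 * n) / 3 - 1)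
  rw [show ((1 - 2 * n) / 3 - 2 + 1 : ℂ) = (1 - 2 * n) / 3 - 1 by ring, e2,
    show ((1 - 2 * n) / 3 - 1 + 1 : ℂ) = (1 - 2 * n) / 3 by ring] at e1
  rw [wrightCoeff, wrightCoeff, Nat.factorial_succ, Nat.factorial_succ, Nat.factorial_succ]
  push_cast
  rw [show (n + 1 + 1 : ℂ) = n + 2 by ring, show (n + 2 + 1 : ℂ) = n + 3 by ring,
    show ((1 - 2 * (n + 3)) / 3 : ℂ) = (1 - 2 * n) / 3 - 2 by ring, e1]
  field_simp
  ring

theorem wrightCoeff_two : wrightCoeff 2 = 0 := by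
  rw [wrightCoeff, show ((1 - 2 * (2 : ℕ)) / 3 : ℂ) = -((1 : ℕ) : ℂ) by norm_num,
    Complex.Gamma_neg_nat_eq_zero, inv_zero, mul_zero]

theorem summable_wrightCoeff (r : ℝ) (hr : 0 ≤ r) : Summable fun n => ‖wrightCoeff n‖ * r ^ n := by
  refine summable_of_three_step_contraction (fun n => by positivity) ?_
  filter_upwards [eventually_ge_atTop ⌈8 * r ^ 3⌉₊] with n hn
  have hn' : 8 * r ^ 3 ≤ n := (Nat.le_ceil _).trans (by exact_mod_cast hn)
  have h := congrArg norm (wrightCoeff_recurrence n)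
  have e1 : ‖((n + 2) * (n + 3) : ℂ)‖ = (n + 2) * (n + 3) := by
    exact_mod_cast Complex.norm_natCast ((n + 2) * (n + 3))
  have e2 : ‖(2 * n + 5 : ℂ)‖ = 2 * n + 5 := by
    exact_mod_cast Complex.norm_natCast (2 * n + 5)
  rw [norm_mul, e1, norm_mul, norm_mul, e2, norm_neg,
    show ‖(2 / 9 : ℂ)‖ = 2 / 9 by norm_num] at h
  have hn0 : (0 : ℝ) ≤ n := by positivity
  set a := ‖wrightCoeff n‖
  set b := ‖wrightCoeff (n + 3)‖
  have ha : 0 ≤ a := norm_nonneg _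
  have hb : 0 ≤ b := norm_nonneg _
  have hb' : b * n ≤ a := by
    have : b * n * (n + 3) ≤ a * (n + 3) := by nlinarith [mul_nonneg hb hn0, mul_nonneg ha hn0]
    exact le_of_mul_le_mul_right this (by positivity)
  have hr3 : b * r ^ 3 ≤ 1 / 8 * a := by nlinarith
  calc b * r ^ (n + 3) = b * r ^ 3 * r ^ n := by ring
    _ ≤ 1 / 8 * a * r ^ n := by gcongr
    _ = _ := by ring

/-- The termwise derivative of `M_{2/3}`. -/
noncomputable def wrightDeriv (z : ℂ) : ℂ := ∑' n : ℕ, wrightCoeff n * (n : ℂ) * z ^ (n - 1)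

theorem hasDerivAt_wrightM (z : ℂ) : HasDerivAt (wrightM (2 / 3)) (wrightDeriv z) z :=
  (funext wrightM_two_thirds_eq : wrightM (2 / 3) = _) ▸
    hasDerivAt_tsum_mul_pow summable_wrightCoeff z

theorem hasDerivAt_wrightDeriv (z : ℂ) : HasDerivAt wrightDeriv
    (-(4 / 9) * z ^ 2 * wrightDeriv z + -(10 / 9) * z * wrightM (2 / 3) z) z := by
  have hs := summable_norm_mul_cast_mul_pow_pred (e := fun n => n) summable_wrightCoeff
  have hs₂ := summable_mul_pow_of_norm
    (summable_norm_mul_cast_mul_pow_pred (e := fun n => n - 1) hs) z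
  have h1 := summable_mul_pow_of_norm (e := fun n => n - 1) hs z
  have h0 := summable_mul_pow_of_norm (e := fun n => n) summable_wrightCoeff z
  convert! hasDerivAt_tsum_mul_pow (e := fun n => n - 1) hs z using 1
  -- The terms `n = 0, 1` die by differentiation and `n = 2` by `wrightCoeff_two`, the pole of `Γ`
  -- at `-1`.
  rw [wrightDeriv, wrightM_two_thirds_eq, ← hs₂.sum_add_tsum_nat_add 3, ← tsum_mul_left,
    ← tsum_mul_left, ← (h1.mul_left _).tsum_add (h0.mul_left _)]
  simp only [Finset.sum_range_succ, Finset.sum_range_zero, wrightCoeff_two]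
  simp only [Nat.cast_zero, Nat.sub_self, mul_zero, zero_mul, Nat.zero_sub, zero_add]
  refine tsum_congr fun n => ?_
  have e : z ^ 2 * ((n : ℂ) * z ^ (n - 1)) = n * z ^ (n + 1) := by
    cases n with
    | zero => simp
    | succ k => rw [Nat.add_sub_cancel]; ring
  rw [show n + 3 - 1 = n + 2 by omega, show n + 2 - 1 = n + 1 by omega]
  push_cast
  linear_combination (-(4 / 9) * wrightCoeff n) * e - z ^ (n + 1) * wrightCoeff_recurrence n

theorem wrightM_two_thirds_zero : wrightM (2 / 3) 0 = (Complex.Gamma (1 / 3))⁻¹ := by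
  rw [wrightM_two_thirds_eq, tsum_eq_single 0 fun k hk => by simp [hk]]
  simp [wrightCoeff]

theorem wrightDeriv_zero : wrightDeriv 0 = (Complex.Gamma (2 / 3))⁻¹ / 3 := by
  rw [wrightDeriv, tsum_eq_single 1 fun k hk => by
    rcases k with _ | _ | k
    · simp
    · exact absurd rfl hk
    · simp]
  have e := Complex.one_div_Gamma_eq_self_mul_one_div_Gamma_add_one (-1 / 3)
  rw [show (-1 / 3 + 1 : ℂ) = 2 / 3 by norm_num] at e
  rw [wrightCoeff, show ((1 - 2 * (1 : ℕ)) / 3 : ℂ) = -1 / 3 by norm_num, e]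
  norm_num
  ring

/-! ### The Airy form of `M_{2/3}` -/

theorem wrightM_two_thirds_eq_airy (z : ℂ) : wrightM (2 / 3) z =
    (cbrtThree⁻¹ * z * airyAi (z ^ 2 / (3 * cbrtThree))
      - cbrtThree * airyAiDeriv (z ^ 2 / (3 * cbrtThree))) * Complex.exp (-2 * z ^ 3 / 27) := by
  have hc := cbrtThree_pow
  have hc0 := cbrtThree_ne_zero
  -- This makes the identities below polynomial in `c`, to be checked modulo `c³ = 3`.
  have hci : cbrtThree⁻¹ = cbrtThree ^ 2 / 3 := by
    field_simp
    linear_combination -hc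
  have hw : ∀ z : ℂ, z ^ 2 / (3 * cbrtThree) = z ^ 2 * cbrtThree ^ 2 / 9 := fun z => by
    rw [div_eq_mul_inv, mul_inv, hci]
    ring
  rw [hw]
  set c := cbrtThree
  have dw : ∀ z : ℂ, HasDerivAt (fun z : ℂ => z ^ 2 * c ^ 2 / 9) (2 * z * c ^ 2 / 9) z := fun z => by
    convert! ((hasDerivAt_pow 2 z).mul_const (c ^ 2)).div_const 9 using 1
    norm_num
  have dE : ∀ z : ℂ, HasDerivAt (fun z : ℂ => Complex.exp (-2 * z ^ 3 / 27))
      (Complex.exp (-2 * z ^ 3 / 27) * (-2 * z ^ 2 / 9)) z := fun z => by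
    convert! (((hasDerivAt_pow 3 z).const_mul (-2)).div_const 27).cexp using 2
    push_cast
    ring
  have dA : ∀ z : ℂ, HasDerivAt (fun z : ℂ => airyAi (z ^ 2 * c ^ 2 / 9))
      (airyAiDeriv (z ^ 2 * c ^ 2 / 9) * (2 * z * c ^ 2 / 9)) z := fun z =>
    (hasDerivAt_airyAi _).comp z (dw z)
  have dB : ∀ z : ℂ, HasDerivAt (fun z : ℂ => airyAiDeriv (z ^ 2 * c ^ 2 / 9))
      (z ^ 2 * c ^ 2 / 9 * airyAi (z ^ 2 * c ^ 2 / 9) * (2 * z * c ^ 2 / 9)) z := fun z =>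
    (hasDerivAt_airyAiDeriv _).comp z (dw z)
  have dh : ∀ z : ℂ, HasDerivAt
      (fun z : ℂ => (c⁻¹ * z * airyAi (z ^ 2 * c ^ 2 / 9) - c * airyAiDeriv (z ^ 2 * c ^ 2 / 9))
        * Complex.exp (-2 * z ^ 3 / 27))
      ((c⁻¹ * (1 - 4 * z ^ 3 / 9) * airyAi (z ^ 2 * c ^ 2 / 9)
        + 4 * c / 9 * z ^ 2 * airyAiDeriv (z ^ 2 * c ^ 2 / 9)) * Complex.exp (-2 * z ^ 3 / 27)) z := by
    intro z
    convert! ((((hasDerivAt_id z).const_mul c⁻¹).mul (dA z)).sub ((dB z).const_mul c)).mul (dE z)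
      using 1
    simp only [hci, id, Pi.sub_apply, Pi.mul_apply]
    generalize airyAi _ = A
    generalize airyAiDeriv _ = B
    generalize Complex.exp _ = E
    linear_combination (-(2 / 27) * c * z ^ 2 * B * E + 2 / 81 * c ^ 2 * z ^ 3 * A * E) * hc
  have dh₁ : ∀ z : ℂ, HasDerivAt
      (fun z : ℂ => (c⁻¹ * (1 - 4 * z ^ 3 / 9) * airyAi (z ^ 2 * c ^ 2 / 9)
        + 4 * c / 9 * z ^ 2 * airyAiDeriv (z ^ 2 * c ^ 2 / 9)) * Complex.exp (-2 * z ^ 3 / 27))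
      (-(4 / 9) * z ^ 2 * ((c⁻¹ * (1 - 4 * z ^ 3 / 9) * airyAi (z ^ 2 * c ^ 2 / 9)
        + 4 * c / 9 * z ^ 2 * airyAiDeriv (z ^ 2 * c ^ 2 / 9)) * Complex.exp (-2 * z ^ 3 / 27))
      + -(10 / 9) * z * ((c⁻¹ * z * airyAi (z ^ 2 * c ^ 2 / 9)
        - c * airyAiDeriv (z ^ 2 * c ^ 2 / 9)) * Complex.exp (-2 * z ^ 3 / 27))) z := by
    intro z
    convert! (((((((hasDerivAt_pow 3 z).const_mul 4).div_const 9).const_sub 1).const_mul c⁻¹).mul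
      (dA z)).add (((hasDerivAt_pow 2 z).const_mul (4 * c / 9)).mul (dB z))).mul (dE z) using 1
    simp only [hci, Pi.add_apply, Pi.mul_apply]
    generalize airyAi _ = A
    generalize airyAiDeriv _ = B
    generalize Complex.exp _ = E
    norm_num
    linear_combination (-(2 / 27) * c * z * (1 - 4 * z ^ 3 / 9) * B * E
      - 8 / 729 * c ^ 2 * z ^ 5 * A * E) * hc
  refine sub_eq_zero.1 (eq_zero_of_linear_ode (p := fun z => -(4 / 9) * z ^ 2)
    (q := fun z => -(10 / 9) * z) (by fun_prop) (by fun_prop)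
    (fun z => (hasDerivAt_wrightM z).sub (dh z)) (fun z => ?_) ?_ ?_ z)
  · convert! (hasDerivAt_wrightDeriv z).sub (dh₁ z) using 1
    simp only [Pi.sub_apply]
    ring
  · simp only [Pi.sub_apply, wrightM_two_thirds_zero]
    simp only [airyAiDeriv, ne_eq, OfNat.ofNat_ne_zero, not_false_eq_true, zero_pow, zero_mul,
      zero_div, mul_zero, airyFDeriv_zero, airyGDeriv_zero, Complex.exp_zero]
    change _ - (0 - c * (0 - c⁻¹ / _ * 1)) * 1 = _
    linear_combination -(Complex.Gamma (1 / 3))⁻¹ * mul_inv_cancel₀ hc0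
  · simp only [wrightDeriv_zero]
    simp only [airyAi_eq, ne_eq, OfNat.ofNat_ne_zero, not_false_eq_true, zero_pow, zero_mul,
      zero_div, mul_zero, airyF_zero, airyG_zero, Complex.exp_zero]
    change _ - (c⁻¹ * (1 - 0) * ((c ^ 2)⁻¹ / _ * 1 - 0) + 0) * 1 = _
    have h3 : c⁻¹ * (c ^ 2)⁻¹ = 1 / 3 := by rw [← mul_inv, ← pow_succ', hc, one_div]
    linear_combination -(Complex.Gamma (2 / 3))⁻¹ * h3

/-! ### Airy functions as Bessel series -/

/-- The entire part `∑ xᵏ / (k! Γ(ν + k + 1))` of the modified Bessel function. -/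
noncomputable def besselSeries (ν x : ℂ) : ℂ :=
  ∑' k : ℕ, x ^ k / ((k.factorial : ℂ) * Complex.Gamma (ν + (k : ℂ) + 1))

/-- The recurrence determines every `c k` from `c 0`; `-1 < ν.re` keeps `Γ(ν + k + 1)` off its
poles. -/
theorem tsum_eq_besselSeries {c : ℕ → ℂ} {ν : ℂ} (hν : -1 < ν.re)
    (hc : ∀ k : ℕ, c (k + 1) * (9 * (k + 1) * (ν + k + 1)) = c k) (w : ℂ) :
    ∑' k, c k * w ^ (3 * k) = c 0 * Complex.Gamma (ν + 1) * besselSeries ν (w ^ 3 / 9) := by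
  have hre : ∀ k : ℕ, 0 < (ν + k + 1).re := fun k => by
    have : (0 : ℝ) ≤ k := by positivity
    simp only [Complex.add_re, Complex.natCast_re, Complex.one_re]
    linarith
  have hne : ∀ k : ℕ, ν + k + 1 ≠ 0 := fun k h => by simpa [h] using hre k
  have hcoeff : ∀ k : ℕ, c k * (9 ^ k * k.factorial * Complex.Gamma (ν + k + 1))
      = c 0 * Complex.Gamma (ν + 1) := by
    intro k
    induction k with
    | zero => simp
    | succ k ih =>
      rw [← ih, ← hc k, Nat.factorial_succ]
      push_cast
      rw [show ν + (k + 1 : ℂ) + 1 = ν + k + 1 + 1 by ring, Complex.Gamma_add_one _ (hne k)]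
      ring
  rw [besselSeries, ← tsum_mul_left]
  refine tsum_congr fun k => ?_
  have hG := Complex.Gamma_ne_zero_of_re_pos (hre k)
  have hf : (k.factorial : ℂ) ≠ 0 := by exact_mod_cast k.factorial_ne_zero
  rw [← hcoeff k, pow_mul, div_pow]
  field_simp

theorem airyF_eq_besselSeries (w : ℂ) :
    airyF w = Complex.Gamma (2 / 3) * besselSeries (-(1 / 3)) (w ^ 3 / 9) := by
  rw [airyF_eq]
  have h := tsum_eq_besselSeries (c := airyFCoeff) (ν := -(1 / 3)) (by norm_num) (fun k => by
    rw [← airyFCoeff_recurrence k]; push_cast; ring) w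
  rw [show (-(1 / 3) + 1 : ℂ) = 2 / 3 by norm_num] at h
  simpa [airyFCoeff] using h

theorem airyG_eq_besselSeries (w : ℂ) :
    airyG w = w * (Complex.Gamma (1 / 3) / 3) * besselSeries (1 / 3) (w ^ 3 / 9) := by
  rw [airyG_eq]
  have h := tsum_eq_besselSeries (c := airyGCoeff) (ν := 1 / 3) (by norm_num) (fun k => by
    rw [← airyGCoeff_recurrence k]; push_cast; ring) w
  rw [Complex.Gamma_add_one _ (by norm_num)] at h
  have h0 : airyGCoeff 0 = 1 := by simp [airyGCoeff]
  simp_rw [pow_succ _ (3 * _), ← mul_assoc]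
  rw [tsum_mul_right, h, h0]
  ring

theorem airyFDeriv_eq_besselSeries (w : ℂ) :
    airyFDeriv w = w ^ 2 * (Complex.Gamma (2 / 3) / 3) * besselSeries (2 / 3) (w ^ 3 / 9) := by
  have hs := summable_mul_pow_of_norm (summable_norm_mul_cast_mul_pow_pred
    (e := fun k => 3 * k + 0) (summable_of_airy_recurrence airyFCoeff_recurrence)) w
  have h := tsum_eq_besselSeries (c := fun k => airyFCoeff (k + 1) * (3 * k + 3)) (ν := 2 / 3)
    (by norm_num) (fun k => by
      rw [← airyFCoeff_recurrence (k + 1)]; push_cast; ring) w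
  rw [Complex.Gamma_add_one _ (by norm_num)] at h
  have h0 : airyFCoeff 1 = 1 / 6 := by
    simp [airyFCoeff, Nat.factorial]
  rw [airyFDeriv, hs.tsum_eq_zero_add]
  have : ∀ k : ℕ, airyFCoeff (k + 1) * ((3 * (k + 1) + 0 : ℕ) : ℂ) * w ^ (3 * (k + 1) + 0 - 1)
      = w ^ 2 * (airyFCoeff (k + 1) * (3 * k + 3) * w ^ (3 * k)) := fun k => by
    rw [show 3 * (k + 1) + 0 - 1 = 3 * k + 2 by omega]
    push_cast
    ring
  simp_rw [this]
  rw [tsum_mul_left, h, zero_add, h0]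
  push_cast
  ring

theorem airyGDeriv_eq_besselSeries (w : ℂ) :
    airyGDeriv w = Complex.Gamma (1 / 3) * besselSeries (-(2 / 3)) (w ^ 3 / 9) := by
  have h := tsum_eq_besselSeries (c := fun k => airyGCoeff k * ((3 * k + 1 : ℕ) : ℂ))
    (ν := -(2 / 3)) (by norm_num) (fun k => by
      rw [← airyGCoeff_recurrence k]; push_cast; ring) w
  rw [show (-(2 / 3) + 1 : ℂ) = 1 / 3 by norm_num] at h
  simpa [airyGDeriv, airyGCoeff] using h

theorem besselK_of_ne_intCast {ν : ℂ} (hν : ∀ m : ℤ, ν ≠ m) (z : ℂ) : besselK ν z =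
    (Real.pi : ℂ) / 2 * (besselI (-ν) z - besselI ν z) / Complex.sin (ν * (Real.pi : ℂ)) := by
  rw [besselK, if_neg (by simpa using hν)]

theorem besselI_two_mul_cube (ν u : ℂ) :
    besselI ν (2 * u ^ 3) = (u ^ 3) ^ ν * besselSeries ν (u ^ 6) := by
  rw [besselI, besselSeries, show 2 * u ^ 3 / 2 = u ^ 3 by ring,
    show (2 * u ^ 3) ^ 2 / 4 = u ^ 6 by ring]

theorem wrightM_two_thirds_eq_besselSeries (z : ℂ) : wrightM (2 / 3) z =
    (z / 3 * besselSeries (-(1 / 3)) ((z / 3) ^ 6)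
      - (z / 3) ^ 3 * besselSeries (1 / 3) ((z / 3) ^ 6)
      + besselSeries (-(2 / 3)) ((z / 3) ^ 6)
      - (z / 3) ^ 4 * besselSeries (2 / 3) ((z / 3) ^ 6)) * Complex.exp (-2 * z ^ 3 / 27) := by
  have hc := cbrtThree_pow
  have hc0 := cbrtThree_ne_zero
  have hw : (z ^ 2 / (3 * cbrtThree)) ^ 3 / 9 = (z / 3) ^ 6 := by
    rw [div_pow, mul_pow, hc]
    ring
  have h1 : Complex.Gamma (1 / 3) ≠ 0 := Complex.Gamma_ne_zero_of_re_pos (by norm_num)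
  have h2 : Complex.Gamma (2 / 3) ≠ 0 := Complex.Gamma_ne_zero_of_re_pos (by norm_num)
  rw [wrightM_two_thirds_eq_airy, airyAi_eq, airyAiDeriv, airyF_eq_besselSeries,
    airyG_eq_besselSeries, airyFDeriv_eq_besselSeries, airyGDeriv_eq_besselSeries, hw]
  congr 1
  generalize besselSeries _ _ = S₁
  generalize besselSeries _ _ = S₂
  generalize besselSeries _ _ = S₃
  generalize besselSeries _ _ = S₄
  field_simp
  rw [hc]
  ring

theorem mainTheorem8 :
    (∀ z : ℂ,
      wrightM (2 / 3) z =
        ((((3 : ℝ) ^ (-(1 / 3) : ℝ) : ℝ) : ℂ) * z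
            * airyAi (z ^ 2 / (((3 : ℝ) ^ (4 / 3 : ℝ) : ℝ) : ℂ))
          - (((3 : ℝ) ^ (1 / 3 : ℝ) : ℝ) : ℂ)
            * deriv airyAi (z ^ 2 / (((3 : ℝ) ^ (4 / 3 : ℝ) : ℝ) : ℂ)))
        * Complex.exp (-2 * z ^ 3 / 27)) ∧
    (∀ z : ℂ, z ≠ 0 → -(Real.pi / 3) < z.arg → z.arg ≤ Real.pi / 3 →
      wrightM (2 / 3) z =
        z ^ 2 / ((((3 : ℝ) ^ (3 / 2 : ℝ) : ℝ) : ℂ) * (Real.pi : ℂ))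
        * (besselK (1 / 3) (2 * z ^ 3 / 27) + besselK (2 / 3) (2 * z ^ 3 / 27))
        * Complex.exp (-2 * z ^ 3 / 27)) := by
  refine ⟨fun z => ?_, fun z hz hlt hle => ?_⟩
  · rw [(hasDerivAt_airyAi _).deriv, ofReal_three_rpow_neg_third, ofReal_three_rpow_four_thirds]
    exact wrightM_two_thirds_eq_airy z
  · have hu0 : z / 3 ≠ 0 := div_ne_zero hz (by norm_num)
    have harg : (z / 3).arg = z.arg := by
      rw [show z / 3 = ((1 / 3 : ℝ) : ℂ) * z by push_cast; ring]
      exact Complex.arg_real_mul z (by norm_num)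
    -- The half-open sector is what the principal cube root requires to return `z / 3`.
    have hroot : ((z / 3) ^ 3) ^ (1 / 3 : ℂ) = z / 3 := by
      have := Complex.pow_cpow_nat_inv (x := z / 3) (n := 3) (by norm_num)
        (by rw [harg]; exact_mod_cast hlt) (by rw [harg]; exact_mod_cast hle)
      simpa using this
    have hroot₂ : ((z / 3) ^ 3) ^ (2 / 3 : ℂ) = (z / 3) ^ 2 := by
      rw [show (2 / 3 : ℂ) = ((2 : ℕ) : ℂ) * (1 / 3) by norm_num, Complex.cpow_nat_mul, hroot]
    have h3 : ∀ m : ℤ, (1 / 3 : ℂ) ≠ m := fun m h => by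
      have : (3 * m : ℂ) = 1 := by rw [← h]; norm_num
      have : 3 * m = 1 := by exact_mod_cast this
      omega
    have h23 : ∀ m : ℤ, (2 / 3 : ℂ) ≠ m := fun m h => by
      have : (3 * m : ℂ) = 2 := by rw [← h]; norm_num
      have : 3 * m = 2 := by exact_mod_cast this
      omega
    have hs1 : Complex.sin (1 / 3 * (Real.pi : ℂ)) = ((√3 : ℝ) : ℂ) / 2 := by
      rw [show (1 / 3 * (Real.pi : ℂ)) = ((Real.pi / 3 : ℝ) : ℂ) by push_cast; ring,
        ← Complex.ofReal_sin, Real.sin_pi_div_three]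
      norm_num
    have hs2 : Complex.sin (2 / 3 * (Real.pi : ℂ)) = ((√3 : ℝ) : ℂ) / 2 := by
      rw [show (2 / 3 * (Real.pi : ℂ)) = Real.pi - 1 / 3 * Real.pi by ring,
        Complex.sin_pi_sub, hs1]
    have hr : (((3 : ℝ) ^ (3 / 2 : ℝ) : ℝ) : ℂ) = 3 * ((√3 : ℝ) : ℂ) := by
      rw [show (3 / 2 : ℝ) = 1 + 1 / 2 by norm_num, Real.rpow_add (by norm_num),
        ← Real.sqrt_eq_rpow]
      norm_num
    have hsq : ((√3 : ℝ) : ℂ) ^ 2 = 3 := by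
      rw [← Complex.ofReal_pow, Real.sq_sqrt (by norm_num)]
      norm_num
    have hsq0 : ((√3 : ℝ) : ℂ) ≠ 0 := fun h => by simp [h] at hsq
    have hpi : (Real.pi : ℂ) ≠ 0 := by exact_mod_cast Real.pi_ne_zero
    rw [wrightM_two_thirds_eq_besselSeries, besselK_of_ne_intCast h3, besselK_of_ne_intCast h23,
      show 2 * z ^ 3 / 27 = 2 * (z / 3) ^ 3 by ring]
    simp only [besselI_two_mul_cube, Complex.cpow_neg, hroot, hroot₂, hs1, hs2, hr]
    congr 1
    obtain ⟨u, rfl⟩ : ∃ u, z = 3 * u := ⟨z / 3, by ring⟩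
    rw [show 3 * u / 3 = u by ring] at *
    generalize besselSeries _ _ = S₁
    generalize besselSeries _ _ = S₂
    generalize besselSeries _ _ = S₃
    generalize besselSeries _ _ = S₄
    -- The constants match since `9u² / (3√3 π) · (π/2) / (√3/2) = u²`.
    field_simp
    rw [hsq]
    ring
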